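/- For integers $n\ge 0$ and $k$, let $I_{n,k}$ (respectively $J_{n,k}$) denote the number of involutions (respectively fixed-point-free involutions) $\pi$ of $\{1,\dots,n\}$ having exactly $k$ descents. Here an involution is a permutation $\pi$ with $\pi^2=\mathrm{id}$ (the identity included), and a descent of $\pi$ is an index $i$ with $1\le i\le n-1$ and $\pi(i)>\pi(i+1)$. In particular $I_{n,k}=J_{n,k}=0$ if $k<0$. Then $$I_{n,k}=I_{n,n-1-k}\qquad\text{for all integers } n\ge 1,\ k\ge 0,$$ and $$J_{2n,k}=J_{2n,2n-k}\qquad\text{for all integers } n\ge 0,\ k\ge 0.$$ -/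

import Mathlib

/-- The descent set of a permutation of `n` ordered letters, written as the word
`π 0, π 1, …, π (n - 1)`: all positions `i` with `i + 1 < n` and `π i > π (i + 1)`. -/
def descentSet {n : ℕ} (π : Equiv.Perm (Fin n)) : Finset (Fin n) :=
  {i : Fin n | ∃ h : (i : ℕ) + 1 < n, π ⟨(i : ℕ) + 1, h⟩ < π i}

/-- The descent number `d(π)`. -/
def descentNumber {n : ℕ} (π : Equiv.Perm (Fin n)) : ℕ :=
  (descentSet π).card

/-- The set of all involutions (the identity included) among the permutations of `n` letters. -/
def involutions (n : ℕ) : Finset (Equiv.Perm (Fin n)) :=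
  {π : Equiv.Perm (Fin n) | ∀ i, π (π i) = i}

/-- The set of all fixed-point-free involutions among the permutations of `n` letters. -/
def fixedPointFreeInvolutions (n : ℕ) : Finset (Equiv.Perm (Fin n)) :=
  {π ∈ involutions n | ∀ i, π i ≠ i}

/-- `I_{n,k}`: the number of involutions of `n` letters with exactly `k` descents.
The index `k` is an integer, so the number is `0` for `k < 0`. -/
def numInvolutions (n : ℕ) (k : ℤ) : ℕ :=
  {π ∈ involutions n | (descentNumber π : ℤ) = k}.card

/-- `J_{n,k}`: the number of fixed-point-free involutions of `n` letters with exactly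
`k` descents. The index `k` is an integer, so the number is `0` for `k < 0`. -/
def numFixedPointFreeInvolutions (n : ℕ) (k : ℤ) : ℕ :=
  {π ∈ fixedPointFreeInvolutions n | (descentNumber π : ℤ) = k}.card

open Finset

/-! The method is that of P-partitions. Pair an involution `π` with a weakly increasing word `f` on
`r` letters that is strict at the descents of `π`, or alternatively at its ascents. In both cases
the multiset of pairs `(f i, f (π i))` determines `(π, f)`, and every swap-invariant multiset of
size `n` arises (`compatibleEquiv`). So the two kinds of pairs are equinumerous.

For a given `π` on `n + 1` letters, the number of words depends only on `r` minus the number of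
forced strict steps (`natCard_strictMono_lex`). Varying `r` gives a unitriangular system, so
descents and ascents are equidistributed (`card_filter_eq_of_sum_eq`).

Having no fixed points means an empty diagonal in the descent case and even diagonal multiplicities
in the ascent case. Halving leaves pairs `a < b`, respectively `a ≤ b`. The shift `(a, b) ↦ (a, b +
1)` matches `r` letters with `r + 1`, which replaces ascents by ascents plus one. -/

/-! ### Existence and uniqueness of sorting -/

lemma eq_of_monotone_of_map_eq {n : ℕ} {β : Type*} [LinearOrder β] {h h' : Fin n → β}
    (hm : Monotone h) (hm' : Monotone h')
    (e : (univ : Finset (Fin n)).val.map h = (univ : Finset (Fin n)).val.map h') : h = h' := by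
  have key : ∀ g : Fin n → β, (univ : Finset (Fin n)).val.map g = (List.ofFn g : Multiset β) := by
    intro g
    rw [Fin.univ_def]
    simp [List.ofFn_eq_map]
  rw [key, key, Multiset.coe_eq_coe] at e
  exact List.ofFn_injective (e.eq_of_sortedLE hm.sortedLE_ofFn hm'.sortedLE_ofFn)

lemma exists_monotone_map_eq {n : ℕ} {β : Type*} [LinearOrder β] (s : Multiset β)
    (hs : s.card = n) :
    ∃ h : Fin n → β, Monotone h ∧ (univ : Finset (Fin n)).val.map h = s := by
  subst hs
  have hl : (s.sort (· ≤ ·)).length = s.card := Multiset.length_sort ..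
  refine ⟨fun i => (s.sort (· ≤ ·)).get (i.cast hl.symm), ?_, ?_⟩
  · intro i j hij
    exact (s.pairwise_sort (· ≤ ·)).sortedLE.monotone_get hij
  · rw [Fin.univ_def]
    conv_rhs => rw [← Multiset.sort_eq s (· ≤ ·)]
    simp only [Multiset.map_coe]
    congr 1
    apply List.ext_get
    · simp
    · intro k h1 h2
      simp

lemma perm_eq_of_monotone_comp {n : ℕ} {β : Type*} [LinearOrder β] {key : Fin n → β}
    (hk : Function.Injective key) {σ τ : Equiv.Perm (Fin n)}
    (hσ : Monotone (key ∘ σ)) (hτ : Monotone (key ∘ τ)) : σ = τ := by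
  have := Tuple.unique_monotone hσ hτ
  ext i
  exact congrArg _ (hk (congrFun this i))

/-! ### Compatible words and symmetric multisets of pairs -/

/-- The word `f` is weakly increasing and `t ∘ π` is strictly increasing wherever `f` is constant. -/
def IsCompatible {n : ℕ} {α T : Type*} [LinearOrder α] [LinearOrder T] (t : Fin n → T)
    (π : Equiv.Perm (Fin n)) (f : Fin n → α) : Prop :=
  StrictMono fun i => toLex (f i, t (π i))

/-- The multiset of all pairs `(f i, f (π i))`. -/
def pairMultiset {n : ℕ} {α : Type*} (π : Equiv.Perm (Fin n)) (f : Fin n → α) :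
    Multiset (α × α) :=
  (univ : Finset (Fin n)).val.map fun i => (f i, f (π i))

section

variable {n : ℕ} {α : Type*} {π : Equiv.Perm (Fin n)} {f : Fin n → α}

lemma card_pairMultiset : (pairMultiset π f).card = n := by
  simp [pairMultiset]

lemma map_univ_comp_perm {β : Type*} (π : Equiv.Perm (Fin n)) (g : Fin n → β) :
    (univ : Finset (Fin n)).val.map (g ∘ π) = (univ : Finset (Fin n)).val.map g := by
  rw [← Multiset.map_map]
  congr 1
  simp

lemma swap_pairMultiset (hπ : ∀ i, π (π i) = i) :
    (pairMultiset π f).map Prod.swap = pairMultiset π f := by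
  conv_rhs => rw [pairMultiset, ← map_univ_comp_perm π]
  simp [pairMultiset, Function.comp_def, hπ]

end

section

variable {n : ℕ} {α C T : Type*} [LinearOrder α] [LinearOrder C] [LinearOrder T]
  {c : α → C} {t : Fin n → T} {π : Equiv.Perm (Fin n)} {f : Fin n → α}

lemma IsCompatible.monotone (h : IsCompatible t π f) : Monotone f := by
  intro i j hij
  rcases hij.eq_or_lt with rfl | hij
  · exact le_rfl
  · rcases Prod.Lex.toLex_lt_toLex.1 (h hij) with h | h
    · exact h.le
    · exact h.1.le

lemma IsCompatible.lt (h : IsCompatible t π f) {i j : Fin n} (hij : i < j) (e : f i = f j) :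
    t (π i) < t (π j) := by
  rcases Prod.Lex.toLex_lt_toLex.1 (h hij) with h | h
  · exact absurd e h.ne
  · exact h.2

variable (H : (StrictMono c ∧ StrictMono t) ∨ (StrictAnti c ∧ StrictAnti t))
include H

/-- The maps `c` and `t` order letters and positions in a common direction: increasing for descents,
decreasing for ascents. Treating both at once yields the two bijections from one argument. -/
lemma le_of_lt_of_common_direction (hf : Monotone f) {x y : Fin n} (h : t x < t y) :
    c (f x) ≤ c (f y) := by
  rcases H with ⟨hc, ht⟩ | ⟨hc, ht⟩
  · exact hc.monotone (hf (ht.lt_iff_lt.1 h).le)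
  · exact hc.antitone (hf (ht.lt_iff_gt.1 h).le)

lemma injective_of_common_direction : Function.Injective c ∧ Function.Injective t := by
  rcases H with ⟨hc, ht⟩ | ⟨hc, ht⟩
  · exact ⟨hc.injective, ht.injective⟩
  · exact ⟨hc.injective, ht.injective⟩

lemma IsCompatible.monotone_lex (h : IsCompatible t π f) :
    Monotone fun i => toLex (f i, c (f (π i))) := by
  intro i j hij
  rcases hij.eq_or_lt with rfl | hij
  · exact le_rfl
  rw [Prod.Lex.toLex_le_toLex]
  rcases Prod.Lex.toLex_lt_toLex.1 (h hij) with h' | h'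
  · exact Or.inl h'
  · exact Or.inr ⟨h'.1, le_of_lt_of_common_direction H h.monotone h'.2⟩

/-- Compatibility lists the pairs in lexicographic order, so the multiset recovers `f` and `f ∘ π`;
then `π` is recovered as the unique permutation sorting an injective key. -/
lemma IsCompatible.eq_of_pairMultiset_eq {π' : Equiv.Perm (Fin n)} {f' : Fin n → α}
    (hπ : ∀ i, π (π i) = i) (hπ' : ∀ i, π' (π' i) = i)
    (h : IsCompatible t π f) (h' : IsCompatible t π' f')
    (e : pairMultiset π f = pairMultiset π' f') : π = π' ∧ f = f' := by
  obtain ⟨hc, ht⟩ := injective_of_common_direction H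
  have e1 := eq_of_monotone_of_map_eq (h.monotone_lex H) (h'.monotone_lex H) (by
    have := congrArg (Multiset.map fun p : α × α => toLex (p.1, c p.2)) e
    simpa [pairMultiset, Function.comp_def] using this)
  have e2 : ∀ i, f i = f' i ∧ f (π i) = f' (π' i) := by
    intro i
    have := congrFun e1 i
    simp only [EmbeddingLike.apply_eq_iff_eq, Prod.mk.injEq] at this
    exact ⟨this.1, hc this.2⟩
  have ef : f = f' := funext fun i => (e2 i).1
  subst ef
  refine ⟨?_, rfl⟩
  -- Since `π` is an involution, `key ∘ π` is `(f i, t (π i))`, which increases by compatibility.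
  let key : Fin n → α ×ₗ T := fun i => toLex (f (π i), t i)
  have hk : Function.Injective key := by
    intro i j hij
    simp only [key, EmbeddingLike.apply_eq_iff_eq, Prod.mk.injEq] at hij
    exact ht hij.2
  apply perm_eq_of_monotone_comp hk
  · have : key ∘ π = fun i => toLex (f i, t (π i)) := funext fun i => by simp [key, hπ]
    rw [this]
    exact StrictMono.monotone h
  · have : key ∘ π' = fun i => toLex (f i, t (π' i)) :=
      funext fun i => by simp [key, (e2 _).2, hπ']
    rw [this]
    exact StrictMono.monotone h'

/-- List the pairs in sorted order as `p` and let `π` sort the swapped pairs, with ties broken by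
`t`. Swap-invariance of `s` gives `p (π i) = (p i).swap`. -/
lemma exists_isCompatible_pairMultiset_eq (s : Multiset (α × α)) (hs : s.card = n)
    (hswap : s.map Prod.swap = s) :
    ∃ (π : Equiv.Perm (Fin n)) (f : Fin n → α), (∀ i, π (π i) = i) ∧ IsCompatible t π f ∧
      pairMultiset π f = s := by
  obtain ⟨hc, ht⟩ := injective_of_common_direction H
  let F : α × α → α ×ₗ C := fun p => toLex (p.1, c p.2)
  have hF : Function.Injective F := by
    intro p q hpq
    simp only [F, EmbeddingLike.apply_eq_iff_eq, Prod.mk.injEq] at hpq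
    exact Prod.ext hpq.1 (hc hpq.2)
  obtain ⟨h, hm, hmap⟩ := exists_monotone_map_eq (s.map F) (n := n) (by simpa using hs)
  have hex : ∀ i, ∃ p ∈ s, F p = h i := by
    intro i
    have : h i ∈ s.map F := by rw [← hmap]; exact Multiset.mem_map_of_mem h (by simp)
    exact Multiset.mem_map.1 this
  choose p hp hFp using hex
  have hps : (univ : Finset (Fin n)).val.map p = s := by
    apply Multiset.map_injective hF
    rw [← hmap, Multiset.map_map]
    exact Multiset.map_congr rfl fun i _ => hFp i
  obtain rfl : h = F ∘ p := funext fun i => (hFp i).symm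
  let k : Fin n → α ×ₗ C := fun i => F (p i).swap
  let key : Fin n → (α ×ₗ C) ×ₗ T := fun i => toLex (k i, t i)
  have hkey : Function.Injective key := by
    intro i j hij
    simp only [key, EmbeddingLike.apply_eq_iff_eq, Prod.mk.injEq] at hij
    exact ht hij.2
  let π := Tuple.sort key
  have hsm : StrictMono (key ∘ π) :=
    (Tuple.monotone_sort key).strictMono_of_injective (hkey.comp π.injective)
  have hkm : Monotone (k ∘ π) := by
    intro i j hij
    rcases Prod.Lex.toLex_le_toLex.1 (hsm.monotone hij) with h | h
    · exact h.le
    · exact h.1.le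
  have hkπ : k ∘ π = F ∘ p := by
    apply eq_of_monotone_of_map_eq hkm hm
    rw [map_univ_comp_perm, hmap, ← hswap, ← hps]
    simp [k, Function.comp_def]
  have hpπ : ∀ i, p (π i) = (p i).swap := by
    intro i
    rw [← hF (congrFun hkπ i), Prod.swap_swap]
  have hlt : ∀ {i j}, i < j → p i = p j → t (π i) < t (π j) := by
    intro i j hij e
    rcases Prod.Lex.toLex_lt_toLex.1 (hsm hij) with h | h
    · simp [k, hpπ, e] at h
    · exact h.2
  have hinv : ∀ i, π (π i) = i := by
    let key' : Fin n → (α ×ₗ C) ×ₗ Fin n := fun i => toLex (F (p i), i)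
    have hkey' : Function.Injective key' := by
      intro i j hij
      simp only [key', EmbeddingLike.apply_eq_iff_eq, Prod.mk.injEq] at hij
      exact hij.2
    -- `π * π` preserves `p` and is increasing on each block of equal pairs, even when `t` is
    -- decreasing, because two reversals cancel. It therefore sorts `key'`, as the identity does.
    have : π * π = 1 := by
      apply perm_eq_of_monotone_comp hkey'
      · refine StrictMono.monotone fun i j hij => ?_
        simp only [key', Function.comp, Equiv.Perm.mul_apply, hpπ, Prod.swap_swap]
        rw [Prod.Lex.toLex_lt_toLex]
        rcases (hm hij.le).eq_or_lt with e | e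
        · refine Or.inr ⟨e, ?_⟩
          have e' := hF e
          have h1 := hlt hij e'
          have e2 : p (π i) = p (π j) := by rw [hpπ, hpπ, e']
          rcases H with ⟨_, ht'⟩ | ⟨_, ht'⟩
          · exact ht'.lt_iff_lt.1 (hlt (ht'.lt_iff_lt.1 h1) e2)
          · exact ht'.lt_iff_gt.1 (hlt (ht'.lt_iff_gt.1 h1) e2.symm)
        · exact Or.inl e
      · intro i j hij
        simp only [key', Function.comp, Equiv.Perm.one_apply]
        rw [Prod.Lex.toLex_le_toLex]
        rcases (hm hij).eq_or_lt with e | e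
        · exact Or.inr ⟨e, hij⟩
        · exact Or.inl e
    exact fun i => Equiv.congr_fun this i
  have hfm : Monotone fun i => (p i).1 := by
    intro i j hij
    rcases Prod.Lex.toLex_le_toLex.1 (hm hij) with h | h
    · exact h.le
    · exact h.1.le
  refine ⟨π, fun i => (p i).1, hinv, ?_, ?_⟩
  · intro i j hij
    rw [Prod.Lex.toLex_lt_toLex]
    rcases Prod.Lex.toLex_le_toLex.1 (hm hij.le) with h | h
    · exact Or.inl h
    · refine Or.inr ⟨h.1, ?_⟩
      rcases h.2.eq_or_lt with e | e
      · exact hlt hij (Prod.ext h.1 (hc e))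
      -- The first coordinate of `p (π i)` is the second coordinate of `p i`, so a reversal of `t`
      -- would contradict `e`.
      · by_contra! hcon
        rcases hcon.eq_or_lt with hcon | hcon
        · exact hij.ne' (π.injective (ht hcon))
        · have := le_of_lt_of_common_direction H hfm hcon
          simp only [hpπ, Prod.fst_swap] at this
          exact absurd e this.not_gt
  · rw [← hps, pairMultiset]
    exact Multiset.map_congr rfl fun i _ => by simp [hpπ]

/-- Involutions with a compatible word correspond to symmetric multisets of pairs. -/
noncomputable def compatibleEquiv :
    {x : Equiv.Perm (Fin n) × (Fin n → α) // (∀ i, x.1 (x.1 i) = i) ∧ IsCompatible t x.1 x.2} ≃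
      {s : Multiset (α × α) // s.card = n ∧ s.map Prod.swap = s} :=
  Equiv.ofBijective
    (fun x => ⟨pairMultiset x.1.1 x.1.2, card_pairMultiset, swap_pairMultiset x.2.1⟩) <| by
    constructor
    · rintro ⟨⟨π, f⟩, h1, h2⟩ ⟨⟨π', f'⟩, h1', h2'⟩ e
      obtain ⟨rfl, rfl⟩ :=
        IsCompatible.eq_of_pairMultiset_eq H h1 h1' h2 h2' (congrArg Subtype.val e)
      rfl
    · rintro ⟨s, hs, hswap⟩
      obtain ⟨π, f, h1, h2, e⟩ := exists_isCompatible_pairMultiset_eq H s hs hswap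
      exact ⟨⟨(π, f), h1, h2⟩, Subtype.ext e⟩

end

/-! ### Fixed points and the diagonal -/

lemma even_card_of_involutive {ι : Type*} [DecidableEq ι] {g : ι → ι} (hg : ∀ i, g (g i) = i)
    (S : Finset ι) (hS : ∀ i ∈ S, g i ∈ S) (hne : ∀ i ∈ S, g i ≠ i) : Even #S := by
  rw [← ZMod.natCast_eq_zero_iff_even]
  have := Finset.sum_involution (s := S) (f := fun _ => (1 : ZMod 2)) (fun i _ => g i)
    (fun _ _ => by decide) (fun i hi _ => hne i hi) hS (fun i _ => hg i)
  simpa using this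

section

variable {n : ℕ} {α : Type*} [LinearOrder α] {π : Equiv.Perm (Fin n)} {f : Fin n → α}

lemma count_pairMultiset (p : α × α) :
    (pairMultiset π f).count p = #{i | f i = p.1 ∧ f (π i) = p.2} := by
  rw [pairMultiset, Multiset.count_map, ← Finset.filter_val, Finset.card_val]
  congr 1
  ext i
  simp [Prod.ext_iff, eq_comm]

/-- On the positions with `f i = f (π i) = a` the involution `π` is increasing, hence the identity:
every diagonal pair comes from a fixed point. -/
lemma IsCompatible.forall_ne_iff_notMem (hπ : ∀ i, π (π i) = i) (h : IsCompatible id π f) :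
    (∀ i, π i ≠ i) ↔ ∀ a, (a, a) ∉ pairMultiset π f := by
  constructor
  · intro hne a ha
    obtain ⟨i, -, hi⟩ := Multiset.mem_map.1 ha
    simp only [Prod.mk.injEq] at hi
    rcases lt_or_gt_of_ne (hne i) with hlt | hlt
    · have := h.lt hlt (hi.2.trans hi.1.symm)
      simp only [hπ, id] at this
      exact hlt.asymm this
    · have := h.lt hlt (hi.1.trans hi.2.symm)
      simp only [hπ, id] at this
      exact hlt.asymm this
  · intro hd i hi
    exact hd (f i) (Multiset.mem_map.2 ⟨i, by simp, by rw [hi]⟩)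

/-- On the positions with `f i = f (π i) = a` the involution `π` is decreasing, so it has at most
one fixed point there, and it has one exactly when their number is odd. -/
lemma IsCompatible.forall_ne_iff_even (hπ : ∀ i, π (π i) = i)
    (h : IsCompatible OrderDual.toDual π f) :
    (∀ i, π i ≠ i) ↔ ∀ a, Even ((pairMultiset π f).count (a, a)) := by
  constructor
  · intro hne a
    rw [count_pairMultiset]
    refine even_card_of_involutive hπ _ ?_ fun i _ => hne i
    intro i hi
    simp only [mem_filter, mem_univ, true_and] at hi ⊢
    exact ⟨hi.2, by rw [hπ]; exact hi.1⟩
  · intro he i hi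
    have h1 := he (f i)
    rw [count_pairMultiset] at h1
    set S : Finset (Fin n) := {j | f j = f i ∧ f (π j) = f i} with hS
    have hiS : i ∈ S := by simp [hS, hi]
    have h2 : Even #(S.erase i) := by
      refine even_card_of_involutive hπ _ ?_ ?_
      · intro j hj
        simp only [hS, mem_erase, mem_filter, mem_univ, true_and, hπ] at hj ⊢
        exact ⟨fun e => hj.1 (by rw [← hπ j, e, hi]), hj.2.2, hj.2.1⟩
      · intro j hj e
        simp only [hS, mem_erase, mem_filter, mem_univ, true_and] at hj
        rcases lt_or_gt_of_ne hj.1 with hlt | hlt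
        · have := h.lt hlt hj.2.1
          rw [e, hi, OrderDual.toDual_lt_toDual] at this
          exact hlt.asymm this
        · have := h.lt hlt hj.2.1.symm
          rw [e, hi, OrderDual.toDual_lt_toDual] at this
          exact hlt.asymm this
    rw [← Finset.card_erase_add_one hiS] at h1
    exact (Nat.even_add_one.1 h1) h2

end

/-! ### Halving symmetric multisets -/

lemma card_add_swap {α : Type*} (t : Multiset (α × α)) :
    (t + t.map Prod.swap).card = 2 * t.card := by
  rw [Multiset.card_add, Multiset.card_map, two_mul]

lemma swap_add_swap {α : Type*} (t : Multiset (α × α)) :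
    (t + t.map Prod.swap).map Prod.swap = t + t.map Prod.swap := by
  simp [add_comm]

section

variable {α : Type*} [LinearOrder α]

lemma count_swap_map (t : Multiset (α × α)) (p : α × α) :
    (t.map Prod.swap).count p = t.count p.swap := by
  conv_lhs => rw [← Prod.swap_swap p]
  exact Multiset.count_map_eq_count' _ _ Prod.swap_injective _

lemma count_add_swap_of_lt {t : Multiset (α × α)} (ht : ∀ p ∈ t, p.1 ≤ p.2) {p : α × α}
    (hp : p.1 < p.2) : (t + t.map Prod.swap).count p = t.count p := by
  rw [Multiset.count_add, count_swap_map, Multiset.count_eq_zero_of_notMem (a := p.swap),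
    add_zero]
  exact fun h => (ht _ h).not_gt hp

lemma count_add_swap_diag (t : Multiset (α × α)) (a : α) :
    (t + t.map Prod.swap).count (a, a) = 2 * t.count (a, a) := by
  rw [Multiset.count_add, count_swap_map, Prod.swap_prod_mk, two_mul]

lemma add_swap_injective {t t' : Multiset (α × α)} (ht : ∀ p ∈ t, p.1 ≤ p.2)
    (ht' : ∀ p ∈ t', p.1 ≤ p.2) (e : t + t.map Prod.swap = t' + t'.map Prod.swap) : t = t' := by
  ext ⟨a, b⟩
  have e' := congrArg (Multiset.count (a, b)) e
  rcases lt_trichotomy a b with h | rfl | h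
  · rwa [count_add_swap_of_lt ht h, count_add_swap_of_lt ht' h] at e'
  · rw [count_add_swap_diag, count_add_swap_diag] at e'
    omega
  · rw [Multiset.count_eq_zero_of_notMem fun hm => (ht _ hm).not_gt h,
      Multiset.count_eq_zero_of_notMem fun hm => (ht' _ hm).not_gt h]

lemma exists_add_swap_eq {s : Multiset (α × α)} (hs : s.map Prod.swap = s)
    (he : ∀ a, Even (s.count (a, a))) :
    ∃ t : Multiset (α × α), (∀ p ∈ t, p.1 ≤ p.2) ∧ t + t.map Prod.swap = s := by
  -- Multiplicities of the half: all of `s` above the diagonal, half of it on the diagonal, nothing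
  -- below.
  let g : α × α → ℕ := fun p =>
    if p.1 < p.2 then s.count p else if p.1 = p.2 then s.count p / 2 else 0
  let t : Multiset (α × α) := ∑ p ∈ s.toFinset, g p • {p}
  have hc : ∀ q, t.count q = g q := by
    intro q
    simp only [t, Multiset.count_sum', Multiset.count_nsmul, Multiset.count_singleton]
    by_cases hq : q ∈ s
    · simp [hq]
    · simp [hq, g]
  refine ⟨t, ?_, ?_⟩
  · intro p hp
    by_contra! h
    have := Multiset.count_pos.2 hp
    rw [hc] at this
    simp [g, h.not_gt, h.ne'] at this
  · ext ⟨a, b⟩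
    have hsw : s.count (b, a) = s.count (a, b) := by
      conv_rhs => rw [← hs]
      rw [count_swap_map, Prod.swap_prod_mk]
    rw [Multiset.count_add, count_swap_map, hc, hc]
    rcases lt_trichotomy a b with h | rfl | h
    · simp [g, h, h.not_gt, h.ne']
    · have := he a
      simp [g]
      obtain ⟨x, hx⟩ := this
      omega
    · simp [g, h, h.not_gt, h.ne', hsw]

lemma natCard_even_diagonal (α : Type*) [LinearOrder α] (m : ℕ) :
    Nat.card {s : Multiset (α × α) //
      (s.card = 2 * m ∧ s.map Prod.swap = s) ∧ ∀ a, Even (s.count (a, a))} =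
    Nat.card {t : Multiset (α × α) // t.card = m ∧ ∀ p ∈ t, p.1 ≤ p.2} := by
  symm
  refine Nat.card_congr (Equiv.ofBijective (fun t => ⟨t.1 + t.1.map Prod.swap,
    ⟨by rw [card_add_swap, t.2.1], swap_add_swap _⟩,
    fun a => by rw [count_add_swap_diag]; exact even_two_mul _⟩) ⟨?_, ?_⟩)
  · intro t t' e
    exact Subtype.ext (add_swap_injective t.2.2 t'.2.2 (congrArg Subtype.val e))
  · rintro ⟨s, ⟨hc, hs⟩, he⟩
    obtain ⟨t, ht, rfl⟩ := exists_add_swap_eq hs he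
    rw [card_add_swap] at hc
    exact ⟨⟨t, by omega, ht⟩, rfl⟩

lemma natCard_zero_diagonal (α : Type*) [LinearOrder α] (m : ℕ) :
    Nat.card {s : Multiset (α × α) //
      (s.card = 2 * m ∧ s.map Prod.swap = s) ∧ ∀ a, (a, a) ∉ s} =
    Nat.card {t : Multiset (α × α) // t.card = m ∧ ∀ p ∈ t, p.1 < p.2} := by
  symm
  refine Nat.card_congr (Equiv.ofBijective (fun t => ⟨t.1 + t.1.map Prod.swap,
    ⟨by rw [card_add_swap, t.2.1], swap_add_swap _⟩, fun a => ?_⟩) ⟨?_, ?_⟩)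
  · rw [← Multiset.count_eq_zero, count_add_swap_diag,
      Multiset.count_eq_zero_of_notMem fun h => (t.2.2 _ h).ne rfl]
  · intro t t' e
    exact Subtype.ext (add_swap_injective (fun p hp => (t.2.2 p hp).le)
      (fun p hp => (t'.2.2 p hp).le) (congrArg Subtype.val e))
  · rintro ⟨s, ⟨hc, hs⟩, he⟩
    obtain ⟨t, ht, rfl⟩ := exists_add_swap_eq hs fun a => by
      rw [Multiset.count_eq_zero_of_notMem (he a)]; exact Even.zero
    rw [card_add_swap] at hc
    refine ⟨⟨t, by omega, fun p hp => (ht p hp).lt_of_ne fun e => he p.1 ?_⟩, rfl⟩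
    have : (p.1, p.1) = p := Prod.ext rfl e
    rw [this]
    exact Multiset.mem_add.2 (Or.inl hp)

lemma exists_multiset_map_eq {β γ : Type*} (φ : β → γ) (s : Multiset γ)
    (h : ∀ y ∈ s, ∃ x, φ x = y) : ∃ t : Multiset β, t.map φ = s := by
  induction s using Multiset.induction_on with
  | empty => exact ⟨0, rfl⟩
  | cons y s ih =>
    obtain ⟨t, rfl⟩ := ih fun z hz => h z (Multiset.mem_cons_of_mem hz)
    obtain ⟨x, rfl⟩ := h y (Multiset.mem_cons_self _ _)
    exact ⟨x ::ₘ t, Multiset.map_cons _ _ _⟩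

/-- The map `(a, b) ↦ (a, b + 1)` turns weak inequalities on `r` letters into strict ones on `r +
1`. -/
lemma natCard_le_pairs_eq_natCard_lt_pairs (r m : ℕ) :
    Nat.card {t : Multiset (Fin r × Fin r) // t.card = m ∧ ∀ p ∈ t, p.1 ≤ p.2} =
    Nat.card {t : Multiset (Fin (r + 1) × Fin (r + 1)) // t.card = m ∧ ∀ p ∈ t, p.1 < p.2} := by
  let φ : Fin r × Fin r → Fin (r + 1) × Fin (r + 1) := Prod.map Fin.castSucc Fin.succ
  have hφ : Function.Injective φ :=
    Function.Injective.prodMap (Fin.castSucc_injective r) (Fin.succ_injective r)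
  have hlt : ∀ p, (φ p).1 < (φ p).2 ↔ p.1 ≤ p.2 := fun p => Fin.castSucc_lt_succ_iff
  refine Nat.card_congr (Equiv.ofBijective (fun t => ⟨t.1.map φ, by simpa using t.2.1, ?_⟩)
    ⟨?_, ?_⟩)
  · intro p hp
    obtain ⟨q, hq, rfl⟩ := Multiset.mem_map.1 hp
    exact (hlt q).2 (t.2.2 q hq)
  · intro t t' e
    exact Subtype.ext (Multiset.map_injective hφ (congrArg Subtype.val e))
  · rintro ⟨s, hs, hl⟩
    obtain ⟨t, rfl⟩ := exists_multiset_map_eq φ s fun p hp => by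
      have h := hl p hp
      refine ⟨(p.1.castPred (Fin.ne_last_of_lt h), p.2.pred (Fin.ne_zero_of_lt h)), ?_⟩
      simp [φ]
    exact ⟨⟨t, by simpa using hs,
      fun p hp => (hlt p).1 (hl _ (Multiset.mem_map_of_mem φ hp))⟩, rfl⟩

end

/-! ### Equinumerosity of the two kinds of compatible pairs -/

/-- Fixed-point-free involutions with a word on `r + 1` letters compatible with the descents are
equinumerous with those having a word on `r` letters compatible with the ascents. -/
lemma natCard_compatible_fixedPointFree (m r : ℕ) :
    Nat.card {x : Equiv.Perm (Fin (2 * m)) × (Fin (2 * m) → Fin (r + 1)) //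
      ((∀ i, x.1 (x.1 i) = i) ∧ IsCompatible id x.1 x.2) ∧ ∀ i, x.1 i ≠ i} =
    Nat.card {x : Equiv.Perm (Fin (2 * m)) × (Fin (2 * m) → Fin r) //
      ((∀ i, x.1 (x.1 i) = i) ∧ IsCompatible OrderDual.toDual x.1 x.2) ∧ ∀ i, x.1 i ≠ i} := by
  have h1 := Nat.card_congr <| (Equiv.subtypeSubtypeEquivSubtypeInter
    (fun x : Equiv.Perm (Fin (2 * m)) × (Fin (2 * m) → Fin (r + 1)) =>
      (∀ i, x.1 (x.1 i) = i) ∧ IsCompatible id x.1 x.2) fun x => ∀ i, x.1 i ≠ i).symm.trans <|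
    ((compatibleEquiv (c := id) (Or.inl ⟨strictMono_id, strictMono_id⟩)).subtypeEquiv
      (q := fun s => ∀ a, (a, a) ∉ s.1) fun x => x.2.2.forall_ne_iff_notMem x.2.1).trans <|
    Equiv.subtypeSubtypeEquivSubtypeInter _ fun s => ∀ a, (a, a) ∉ s
  have h2 := Nat.card_congr <| (Equiv.subtypeSubtypeEquivSubtypeInter
    (fun x : Equiv.Perm (Fin (2 * m)) × (Fin (2 * m) → Fin r) =>
      (∀ i, x.1 (x.1 i) = i) ∧ IsCompatible OrderDual.toDual x.1 x.2)
      fun x => ∀ i, x.1 i ≠ i).symm.trans <|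
    ((compatibleEquiv (c := OrderDual.toDual) (Or.inr ⟨fun _ _ h => h, fun _ _ h => h⟩)).subtypeEquiv
      (q := fun s => ∀ a, Even (s.1.count (a, a)))
      fun x => x.2.2.forall_ne_iff_even x.2.1).trans <|
    Equiv.subtypeSubtypeEquivSubtypeInter _
      fun s : Multiset (Fin r × Fin r) => ∀ a, Even (s.count (a, a))
  rw [h1, h2, natCard_zero_diagonal, natCard_even_diagonal, natCard_le_pairs_eq_natCard_lt_pairs]

/-- Involutions with a word compatible with the descents are equinumerous with those having a
word compatible with the ascents. -/
lemma natCard_compatible (n r : ℕ) :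
    Nat.card {x : Equiv.Perm (Fin n) × (Fin n → Fin r) //
      (∀ i, x.1 (x.1 i) = i) ∧ IsCompatible id x.1 x.2} =
    Nat.card {x : Equiv.Perm (Fin n) × (Fin n → Fin r) //
      (∀ i, x.1 (x.1 i) = i) ∧ IsCompatible OrderDual.toDual x.1 x.2} :=
  Nat.card_congr <|
    (compatibleEquiv (c := id) (Or.inl ⟨strictMono_id, strictMono_id⟩)).trans
      (compatibleEquiv (c := OrderDual.toDual) (Or.inr ⟨fun _ _ h => h, fun _ _ h => h⟩)).symm

/-! ### Counting the words compatible with a given permutation -/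

/-- The number of weakly increasing words of length `n + 1` on `s` letters. -/
noncomputable def monotoneCount (n s : ℕ) : ℕ :=
  Nat.card {g : Fin (n + 1) → Fin s // Monotone g}

section

variable {n : ℕ} {T : Type*} [LinearOrder T]

/-- The positions at which the word `w` fails to increase. -/
def weakDescents (w : Fin (n + 1) → T) : Finset (Fin n) :=
  {i | ¬ w i.castSucc < w i.succ}

/-- The number of weak descents of `w` strictly before `i`. -/
def weakDescentsBefore (w : Fin (n + 1) → T) (i : Fin (n + 1)) : ℕ :=
  #{j ∈ weakDescents w | j.castSucc < i}

lemma weakDescentsBefore_zero (w : Fin (n + 1) → T) : weakDescentsBefore w 0 = 0 := by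
  simp [weakDescentsBefore]

lemma weakDescentsBefore_last (w : Fin (n + 1) → T) :
    weakDescentsBefore w (Fin.last n) = #(weakDescents w) := by
  simp [weakDescentsBefore, Fin.castSucc_lt_last]

lemma weakDescentsBefore_succ (w : Fin (n + 1) → T) (i : Fin n) :
    weakDescentsBefore w i.succ =
      weakDescentsBefore w i.castSucc + if w i.castSucc < w i.succ then 0 else 1 := by
  have key : ∀ j : Fin n, j.castSucc < i.succ ↔ j.castSucc < i.castSucc ∨ j = i := by
    intro j
    simp only [Fin.lt_def, Fin.val_castSucc, Fin.val_succ, Fin.ext_iff]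
    omega
  rw [weakDescentsBefore, weakDescentsBefore]
  simp only [key, Finset.filter_or]
  rw [Finset.card_union_of_disjoint]
  · congr 1
    rw [Finset.filter_eq']
    by_cases h : w i.castSucc < w i.succ <;> simp [weakDescents, h, not_lt.1]
  · rw [Finset.disjoint_filter]
    rintro j - h rfl
    exact h.false

/-- Subtracting the number of earlier weak descents lowers each forced strict step to a weak one.
The difference is taken in `ℤ` to avoid truncation. -/
lemma strictMono_lex_iff {r : ℕ} (w : Fin (n + 1) → T) (f : Fin (n + 1) → Fin r) :
    (StrictMono fun i => toLex (f i, w i)) ↔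
      Monotone fun i => ((f i : ℕ) : ℤ) - weakDescentsBefore w i := by
  rw [Fin.strictMono_iff_lt_succ, Fin.monotone_iff_le_succ]
  refine forall_congr' fun i => ?_
  rw [weakDescentsBefore_succ, Prod.Lex.toLex_lt_toLex, Fin.lt_def, Fin.ext_iff]
  split_ifs with h
  · simp only [h, and_true]
    push_cast
    omega
  · simp only [h, and_false, or_false]
    push_cast
    omega

/-- The number of words that increase weakly, and strictly at the weak descents of `w`, depends
only on the number of these weak descents. -/
lemma natCard_strictMono_lex (r : ℕ) (w : Fin (n + 1) → T) :
    Nat.card {f : Fin (n + 1) → Fin r // StrictMono fun i => toLex (f i, w i)} =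
      monotoneCount n (r - #(weakDescents w)) := by
  have hle : ∀ i, weakDescentsBefore w i ≤ #(weakDescents w) := fun i => card_filter_le _ _
  symm
  refine Nat.card_congr (Equiv.ofBijective
    (fun g => ⟨fun i => ⟨g.1 i + weakDescentsBefore w i, ?_⟩, ?_⟩) ⟨?_, ?_⟩)
  · have := (g.1 i).2
    have := hle i
    omega
  · rw [strictMono_lex_iff]
    intro i j hij
    have : (g.1 i : ℕ) ≤ g.1 j := g.2 hij
    simpa using this
  · intro g g' e
    refine Subtype.ext (funext fun i => Fin.ext ?_)
    have := congrArg Fin.val (congrFun (congrArg Subtype.val e) i)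
    simpa using this
  · rintro ⟨f, hf⟩
    have hf' := (strictMono_lex_iff w f).1 hf
    -- Comparison with the first position bounds the shifted word below by `0`; comparison with the
    -- last one gives the upper bound `h1`.
    have h0 : ∀ i, weakDescentsBefore w i ≤ f i := by
      intro i
      have := hf' (Fin.zero_le i)
      simp only [weakDescentsBefore_zero] at this
      omega
    have h1 : ∀ i, (f i : ℕ) - weakDescentsBefore w i < r - #(weakDescents w) := by
      intro i
      have := hf' (Fin.le_last i)
      simp only [weakDescentsBefore_last] at this
      have := (f (Fin.last n)).2
      have := h0 i
      omega
    refine ⟨⟨fun i => ⟨f i - weakDescentsBefore w i, h1 i⟩, ?_⟩, ?_⟩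
    · intro i j hij
      have := hf' hij
      have := h0 i
      have := h0 j
      rw [Fin.le_def]
      dsimp only at *
      omega
    · refine Subtype.ext (funext fun i => Fin.ext ?_)
      have := h0 i
      dsimp only
      omega

end

lemma monotoneCount_zero (n : ℕ) : monotoneCount n 0 = 0 := by
  rw [monotoneCount, Nat.card_eq_zero]
  exact Or.inl ⟨fun g => (g.1 0).elim0⟩

lemma monotoneCount_one (n : ℕ) : monotoneCount n 1 = 1 := by
  rw [monotoneCount, Nat.card_eq_one_iff_unique]
  exact ⟨inferInstance, ⟨⟨fun _ => 0, monotone_const⟩⟩⟩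

/-! ### From word counts to the distribution of descents -/

/-- Two statistics with equal unitriangular transforms are equidistributed. -/
lemma card_filter_eq_of_sum_eq {ι : Type*} (X : Finset ι) (p q : ι → ℕ) (M : ℕ → ℕ)
    (h0 : M 0 = 0) (h1 : M 1 = 1) (h : ∀ r, ∑ x ∈ X, M (r - p x) = ∑ x ∈ X, M (r - q x)) (d : ℕ) :
    #{x ∈ X | p x = d} = #{x ∈ X | q x = d} := by
  have expand : ∀ (u : ι → ℕ) (r : ℕ),
      ∑ x ∈ X, M (r - u x) = ∑ d ∈ range r, #{x ∈ X | u x = d} * M (r - d) := by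
    intro u r
    have : ∀ x ∈ X, M (r - u x) = ∑ d ∈ range r, if u x = d then M (r - d) else 0 := by
      intro x _
      rw [Finset.sum_ite_eq]
      split_ifs with hx
      · rfl
      · rw [Nat.sub_eq_zero_of_le (by simpa using hx), h0]
    rw [Finset.sum_congr rfl this, Finset.sum_comm]
    refine Finset.sum_congr rfl fun d _ => ?_
    rw [← Finset.sum_filter, Finset.sum_const, smul_eq_mul]
  induction d using Nat.strong_induction_on with
  | _ d ih =>
    -- At `r = d + 1` the top term is the count for `d` times `M 1 = 1`; the lower terms agree by
    -- induction.
    have := h (d + 1)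
    rw [expand, expand, Finset.sum_range_succ, Finset.sum_range_succ,
      Finset.sum_congr rfl fun e he => by rw [ih e (Finset.mem_range.1 he)]] at this
    simpa [h1] using this

lemma card_weakDescents_perm {n : ℕ} (π : Equiv.Perm (Fin (n + 1))) :
    #(weakDescents fun i => (id (π i) : Fin (n + 1))) = descentNumber π := by
  rw [descentNumber, ← Finset.card_map Fin.castSuccEmb]
  congr 1
  ext i
  simp only [weakDescents, descentSet, mem_map, mem_filter, mem_univ, true_and, id]
  constructor
  · rintro ⟨j, hj, rfl⟩
    exact ⟨by simp, lt_of_le_of_ne (not_lt.1 hj)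
      (π.injective.ne (by simp [Fin.ext_iff]))⟩
  · rintro ⟨h, hi⟩
    exact ⟨⟨i, by omega⟩, hi.not_gt, rfl⟩

/-- In the reversed order the weak descents are the ascents of `π`, which are complementary to its
descents because `π` has no repeated values. -/
lemma card_weakDescents_toDual_perm {n : ℕ} (π : Equiv.Perm (Fin (n + 1))) :
    #(weakDescents fun i => OrderDual.toDual (π i)) + descentNumber π = n := by
  rw [← card_weakDescents_perm]
  have : weakDescents (fun i => OrderDual.toDual (π i)) =
      (weakDescents fun i => (id (π i) : Fin (n + 1)))ᶜ := by
    ext i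
    have : π i.castSucc ≠ π i.succ := π.injective.ne (by simp [Fin.ext_iff])
    simp only [weakDescents, mem_filter, mem_univ, true_and, mem_compl, id,
      OrderDual.toDual_lt_toDual, not_lt]
    exact ⟨fun h => (h.lt_of_ne this).not_ge, fun h => (not_le.1 h).le⟩
  rw [this, Finset.card_compl_add_card, Fintype.card_fin]

lemma natCard_compatible_eq_sum {n r : ℕ} {T : Type*} [LinearOrder T] (t : Fin (n + 1) → T)
    (X : Finset (Equiv.Perm (Fin (n + 1)))) :
    Nat.card {x : Equiv.Perm (Fin (n + 1)) × (Fin (n + 1) → Fin r) //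
      x.1 ∈ X ∧ IsCompatible t x.1 x.2} =
    ∑ π ∈ X, monotoneCount n (r - #(weakDescents fun i => t (π i))) := by
  have e : {x : Equiv.Perm (Fin (n + 1)) × (Fin (n + 1) → Fin r) //
      x.1 ∈ X ∧ IsCompatible t x.1 x.2} ≃
      Σ π : X, {f : Fin (n + 1) → Fin r // IsCompatible t π.1 f} :=
    { toFun := fun x => ⟨⟨x.1.1, x.2.1⟩, ⟨x.1.2, x.2.2⟩⟩
      invFun := fun y => ⟨(y.1.1, y.2.1), y.1.2, y.2.2⟩
      left_inv := fun _ => rfl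
      right_inv := fun _ => rfl }
  rw [Nat.card_congr e, Nat.card_sigma, ← Finset.sum_coe_sort X]
  exact Finset.sum_congr rfl fun π _ => natCard_strictMono_lex r _

lemma mem_involutions {n : ℕ} {π : Equiv.Perm (Fin n)} :
    π ∈ involutions n ↔ ∀ i, π (π i) = i := by
  simp [involutions]

lemma mem_fixedPointFreeInvolutions {n : ℕ} {π : Equiv.Perm (Fin n)} :
    π ∈ fixedPointFreeInvolutions n ↔ (∀ i, π (π i) = i) ∧ ∀ i, π i ≠ i := by
  simp [fixedPointFreeInvolutions, mem_involutions]

/-- Descents and ascents are equidistributed on involutions. -/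
lemma card_involutions_descentNumber (n d : ℕ) :
    #{π ∈ involutions (n + 1) | descentNumber π = d} =
      #{π ∈ involutions (n + 1) | n - descentNumber π = d} := by
  refine card_filter_eq_of_sum_eq _ _ _
    (monotoneCount n) (monotoneCount_zero n) (monotoneCount_one n) (fun r => ?_) d
  have h := natCard_compatible (n + 1) r
  simp only [← mem_involutions] at h
  rw [natCard_compatible_eq_sum, natCard_compatible_eq_sum] at h
  refine (Finset.sum_congr rfl fun π _ => ?_).trans (h.trans (Finset.sum_congr rfl fun π _ => ?_))
  · rw [card_weakDescents_perm]
  · have := card_weakDescents_toDual_perm π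
    congr 1
    omega

/-- On fixed-point-free involutions the number of descents has the same distribution as the
number of ascents increased by one. -/
lemma card_fixedPointFreeInvolutions_descentNumber {n m : ℕ} (hn : n + 1 = 2 * m) (d : ℕ) :
    #{π ∈ fixedPointFreeInvolutions (n + 1) | descentNumber π = d} =
      #{π ∈ fixedPointFreeInvolutions (n + 1) | n + 1 - descentNumber π = d} := by
  refine card_filter_eq_of_sum_eq _ _ _
    (monotoneCount n) (monotoneCount_zero n) (monotoneCount_one n) (fun r => ?_) d
  -- The comparison is between `r + 1` and `r` letters, so `r = 0` is separate; there every term is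
  -- `monotoneCount n 0 = 0`.
  rcases r with _ | r
  · simp only [Nat.zero_sub, monotoneCount_zero]
  have e (T : Type) [LinearOrder T] (t : Fin (n + 1) → T) (s : ℕ) :
      Nat.card {x : Equiv.Perm (Fin (n + 1)) × (Fin (n + 1) → Fin s) //
        ((∀ i, x.1 (x.1 i) = i) ∧ IsCompatible t x.1 x.2) ∧ ∀ i, x.1 i ≠ i} =
      Nat.card {x : Equiv.Perm (Fin (n + 1)) × (Fin (n + 1) → Fin s) //
        x.1 ∈ fixedPointFreeInvolutions (n + 1) ∧ IsCompatible t x.1 x.2} :=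
    Nat.card_congr (Equiv.subtypeEquivRight fun x => by
      rw [mem_fixedPointFreeInvolutions, and_right_comm])
  have h := natCard_compatible_fixedPointFree m r
  rw [← hn, e, e] at h
  rw [natCard_compatible_eq_sum, natCard_compatible_eq_sum] at h
  refine (Finset.sum_congr rfl fun π _ => ?_).trans (h.trans (Finset.sum_congr rfl fun π _ => ?_))
  · rw [card_weakDescents_perm]
  · have := card_weakDescents_toDual_perm π
    congr 1
    omega

lemma descentNumber_le {n : ℕ} (π : Equiv.Perm (Fin (n + 1))) : descentNumber π ≤ n := by
  have := card_weakDescents_toDual_perm π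
  omega

lemma numInvolutions_symm (n : ℕ) (k : ℕ) :
    numInvolutions (n + 1) k = numInvolutions (n + 1) (n - k : ℤ) := by
  unfold numInvolutions
  convert card_involutions_descentNumber n k using 3 with π _ π _
  · exact Nat.cast_inj
  · have := descentNumber_le π
    omega

lemma numFixedPointFreeInvolutions_symm {n m : ℕ} (hn : n + 1 = 2 * m) (k : ℕ) :
    numFixedPointFreeInvolutions (n + 1) k =
      numFixedPointFreeInvolutions (n + 1) ((n + 1 : ℕ) - k : ℤ) := by
  unfold numFixedPointFreeInvolutions
  convert card_fixedPointFreeInvolutions_descentNumber hn k using 3 with π _ π _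
  · exact Nat.cast_inj
  · have := descentNumber_le π
    omega

theorem mainTheorem5 :
    (∀ n k : ℕ, 1 ≤ n →
      numInvolutions n (k : ℤ) = numInvolutions n ((n : ℤ) - 1 - (k : ℤ))) ∧
    (∀ n k : ℕ,
      numFixedPointFreeInvolutions (2 * n) (k : ℤ) =
        numFixedPointFreeInvolutions (2 * n) (2 * (n : ℤ) - (k : ℤ))) := by
  constructor
  · intro n k hn
    obtain ⟨n, rfl⟩ : ∃ l, n = l + 1 := ⟨n - 1, by omega⟩
    rw [numInvolutions_symm]
    congr 1
    push_cast
    ring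
  · intro n k
    -- The counting argument needs nonempty words. On no letters there are no descents, and `k = 0`
    -- iff `-k = 0`.
    rcases n with _ | n
    · unfold numFixedPointFreeInvolutions
      have h (π : Equiv.Perm (Fin (2 * 0))) : descentNumber π = 0 := by
        rw [descentNumber, Finset.card_eq_zero]
        exact Finset.eq_empty_of_forall_notMem fun i => i.elim0
      simp [h, eq_comm]
    · have h := numFixedPointFreeInvolutions_symm (n := 2 * n + 1) (m := n + 1) (by ring) k
      push_cast at h ⊢
      rwa [show 2 * (n : ℤ) + 1 + 1 = 2 * (n + 1) by ring] at h
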